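/- **Theorem 1 (ASE gap for random subspaces).** For $d,n$ with $d\ge 1$, let $(\mathbb C^d)^{\otimes n}$ carry the Weyl–Heisenberg displacement operators $D_{\mathbf a}=D_{\mathbf a_1}\otimes\cdots\otimes D_{\mathbf a_n}$, $\mathbf a\in(\mathbb Z_d^2)^n$, where $D_{(a_1,a_2)}=\tau^{a_1a_2}X^{a_1}Z^{a_2}$ for $a_1,a_2\in\{0,\dots,d-1\}$, $\tau=-e^{i\pi/d}$, $X|k\rangle=|k+1 \bmod d\rangle$, $Z|k\rangle=e^{2\pi i k/d}|k\rangle$. The linear stabilizer entropy of a pure state $\psi=|\psi\rangle\langle\psi|$ is $$M(\psi)=1-\frac1{d^n}\sum_{\mathbf a}\bigl|\mathrm{Tr}(D_{\mathbf a}^\dagger\psi)\bigr|^4 .$$ Let $\mathcal H_{d_S}$ and $\mathcal H_{d_B}$ be two such spaces, of total dimensions $d_S\le d_B$ (with possibly different local dimensions and numbers of qudits), and let $M_S$, $M_B$ be their linear stabilizer entropies. For an isometric embedding $\mathcal E:\mathcal H_{d_S}\to\mathcal H_{d_B}$ put $$\Delta M(\mathcal E)=\mathbb E_U\bigl[M_B(\mathcal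 E(U\psi U^\dagger))-M_S(U\psi U^\dagger)\bigr],$$ where $U$ is Haar distributed on $U(d_S)$ and $\psi$ is any fixed pure state of $\mathcal H_{d_S}$. There is a unitarily invariant probability measure on the set of $d_S$-dimensional subspaces of $\mathcal H_{d_B}$. Let $W$ be distributed according to any such measure, and for each $W$ let $\mathcal E_W$ be any isometric embedding with image $W$. Then $\Delta M(\mathcal E_W)$ and $\mathbb E_U[M_B(\mathcal E_W(U\psi U^\dagger))]$ are integrable functions of $W$ and, for all pure states $\psi$ of $\mathcal H_{d_S}$ and $\varphi$ of $\mathcal H_{d_B}$, $$\mathbb E_W\bigl[\Delta M(\mathcal E_W)\bigr]=\mathbb E_{V}\bigl[M_B(V\varphi V^\dagger)\bigr]-\mathbb E_{U}\bigl[M_S(U\psi U^\dagger)\bigr],$$ and equivalently $$\mathbb E_W\,\mathbb E_{U}\bigl[M_B(\mathcal E_W(U\psi U^\dagger))\bigr]=\mathbb E_{V}\bigl[M_B(V\varphi V^\dagger)\bigr],$$ where $U$ and $V$ are Haar distributed on $U(d_S)$ and $U(d_B)$. -/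

import Mathlib

open MeasureTheory

noncomputable section

/-! ### Weyl–Heisenberg operators and stabilizer entropy -/

/-- The Hilbert space `(ℂ^d)^{⊗ n}` of `n` qudits of local dimension `d`, in coordinates with
respect to the computational basis `|k₁ … kₙ⟩`, `kᵢ ∈ ℤ/d`. Its dimension is `d ^ n`. -/
abbrev QuditSpace (d n : ℕ) [NeZero d] : Type := EuclideanSpace ℂ (Fin n → ZMod d)

/-- The clock operator `Z|k⟩ = ω^k |k⟩`, `ω = exp(2πi/d)`. -/
def clock (d : ℕ) [NeZero d] : Matrix (ZMod d) (ZMod d) ℂ :=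
  Matrix.diagonal fun k => Complex.exp (2 * Real.pi * Complex.I / d) ^ k.val

/-- The shift operator `X|k⟩ = |k + 1 mod d⟩`. -/
def shift (d : ℕ) [NeZero d] : Matrix (ZMod d) (ZMod d) ℂ :=
  Matrix.of fun i j => if i = j + 1 then 1 else 0

/-- The single-qudit displacement operator `D_a = τ^{a₁ a₂} X^{a₁} Z^{a₂}` with
`τ = -exp(πi/d)`; the indices are represented by integers in `{0, …, d - 1}`. -/
def displacement (d : ℕ) [NeZero d] (a : ZMod d × ZMod d) : Matrix (ZMod d) (ZMod d) ℂ :=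
  (-Complex.exp (Real.pi * Complex.I / d)) ^ (a.1.val * a.2.val) •
    (shift d ^ a.1.val * clock d ^ a.2.val)

/-- The `n`-qudit displacement operator `D_{a₁} ⊗ ⋯ ⊗ D_{aₙ}`. -/
def multiDisplacement (d n : ℕ) [NeZero d] (a : Fin n → ZMod d × ZMod d) :
    Matrix (Fin n → ZMod d) (Fin n → ZMod d) ℂ :=
  Matrix.of fun i j => ∏ k, displacement d (a k) (i k) (j k)

/-- The operator `|ψ⟩⟨ψ|`. -/
def pureState {d n : ℕ} [NeZero d] (ψ : QuditSpace d n) :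
    Matrix (Fin n → ZMod d) (Fin n → ZMod d) ℂ :=
  Matrix.of fun i j => ψ i * star (ψ j)

/-- `P_a(ρ) = |Tr(D_a† ρ)|² / d^n`. -/
def weylProb {d n : ℕ} [NeZero d] (ρ : Matrix (Fin n → ZMod d) (Fin n → ZMod d) ℂ)
    (a : Fin n → ZMod d × ZMod d) : ℝ :=
  ‖((multiDisplacement d n a).conjTranspose * ρ).trace‖ ^ 2 / (d : ℝ) ^ n

/-- The linear stabilizer entropy (of order two) of the pure state `|ψ⟩⟨ψ|`:
`M(ψ) = 1 - d^n ∑_a P_a(ψ)²`. -/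
def stabEntropy {d n : ℕ} [NeZero d] (ψ : QuditSpace d n) : ℝ :=
  1 - (d : ℝ) ^ n * ∑ a : Fin n → ZMod d × ZMod d, weylProb (pureState ψ) a ^ 2

/-! ### Haar averages -/

section Haar

variable (E : Type*) [NormedAddCommGroup E] [InnerProductSpace ℂ E] [FiniteDimensional ℂ E]
  [CompleteSpace E]

/-- The unitary group of the Hilbert space `E`. -/
abbrev UnitaryOp : Type _ := unitary (E →L[ℂ] E)

instance instCompactSpaceUnitaryOp : CompactSpace (UnitaryOp E) := by
  have : ProperSpace (E →L[ℂ] E) := FiniteDimensional.proper ℂ _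
  refine isCompact_iff_compactSpace.mp (Metric.isCompact_of_isClosed_isBounded ?_ ?_)
  · have : (unitary (E →L[ℂ] E) : Set (E →L[ℂ] E)) =
        {u | star u * u = 1} ∩ {u | u * star u = 1} := by
      ext u; exact Unitary.mem_iff
    rw [this]
    exact (isClosed_eq (by fun_prop) continuous_const).inter
      (isClosed_eq (by fun_prop) continuous_const)
  · refine (Metric.isBounded_closedBall (x := (0 : E →L[ℂ] E)) (r := 1)).subset fun u hu => ?_
    rw [mem_closedBall_zero_iff]
    refine ContinuousLinearMap.opNorm_le_bound _ zero_le_one fun x => ?_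
    rw [one_mul]
    exact (Unitary.norm_map (⟨u, hu⟩ : unitary (E →L[ℂ] E)) x).le

/-- The Haar probability measure on the unitary group. -/
def unitaryHaar : Measure (UnitaryOp E) := Measure.haarMeasure ⊤

variable {E}

/-- The Haar average `𝔼_U[f(Uψ)]`. -/
def haarAverage (f : E → ℝ) (ψ : E) : ℝ :=
  ∫ U : UnitaryOp E, f ((U : E →L[ℂ] E) ψ) ∂(unitaryHaar E)

/-! ### The Grassmannian and its unitary action -/

variable (E) in
/-- The set of `k`-dimensional subspaces of `E`. -/
def SubspacesOfDim (k : ℕ) : Type _ := {W : Submodule ℂ E // Module.finrank ℂ W = k}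

/-- A subspace is identified with its orthogonal projector for the purpose of measurability. -/
instance instMeasurableSpaceSubspaces (k : ℕ) : MeasurableSpace (SubspacesOfDim E k) :=
  MeasurableSpace.comap (fun W => W.1.starProjection) (borel (E →L[ℂ] E))

/-- `U • W = U(W)`. -/
instance instSMulSubspaces (k : ℕ) : SMul (UnitaryOp E) (SubspacesOfDim E k) where
  smul U W := ⟨W.1.map (U : E →L[ℂ] E).toLinearMap,
    (LinearEquiv.finrank_eq (Submodule.equivMapOfInjective _
      (fun _ _ h => (Unitary.linearIsometryEquiv U).injective h) W.1)).symm.trans W.2⟩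

end Haar

/-! ### The stabilizer entropy gap -/

section Gap

variable {dS nS dB nB : ℕ} [NeZero dS] [NeZero dB]

/-- The stabilizer entropy gap `M_B(ℰ(ψ)) - M_S(ψ)` of a state `ψ` of the small system under an
isometric embedding `ℰ` into the big system. -/
def stateGap (ℰ : QuditSpace dS nS →ₗᵢ[ℂ] QuditSpace dB nB) (ψ : QuditSpace dS nS) : ℝ :=
  stabEntropy (ℰ ψ) - stabEntropy ψ

/-- The average stabilizer entropy gap `ΔM(ℰ) = 𝔼_U[M_B(ℰ(Uψ)) - M_S(Uψ)]`, with fiducial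
state `ψ`. -/
def aseGap (ℰ : QuditSpace dS nS →ₗᵢ[ℂ] QuditSpace dB nB) (ψ : QuditSpace dS nS) : ℝ :=
  haarAverage (stateGap ℰ) ψ

/-- The average extrinsic stabilizer entropy `𝔼_U[M_B(ℰ(Uψ))]` of the image of `ℰ`. -/
def extrinsicASE (ℰ : QuditSpace dS nS →ₗᵢ[ℂ] QuditSpace dB nB) (ψ : QuditSpace dS nS) : ℝ :=
  haarAverage (fun φ => stabEntropy (ℰ φ)) ψ

end Gap

end

open Measure

set_option linter.unusedSectionVars false

section HaarUnitary

variable {E : Type*} [NormedAddCommGroup E] [InnerProductSpace ℂ E] [FiniteDimensional ℂ E]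
  [CompleteSpace E]

/-! Only continuity of the stabilizer entropy matters. By invariance of the law of `W`, one may
replace `W` by `V • W` and average over Haar `V`. The embeddings `ℰ (V • W)` and `V ∘ ℰ W` have the
same image, hence the same average over `U` (`haarAverage_smul_subspaces`). After Fubini, for fixed
`W` and `U`, the vector `V (ℰ W (U ψ))` is a Haar-random unit vector of the big space, whatever `W`
and `U` are (`integral_haarAverage_unitaryOp`). The intrinsic term of the gap does not depend on `W`
and is subtracted as a constant.

Since `ℰ` is an arbitrary choice, measurability in `W` is not automatic; it follows from compactness
of the unitary group and transitivity of its action (`measurable_haarAverage_subspaces`). -/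

instance instSecondCountableUnitaryOp : SecondCountableTopology (UnitaryOp E) :=
  have : ProperSpace (E →L[ℂ] E) := FiniteDimensional.proper ℂ _
  inferInstanceAs (SecondCountableTopology (unitary (E →L[ℂ] E) : Set (E →L[ℂ] E)))

instance instIsHaarMeasureUnitaryHaar : IsHaarMeasure (unitaryHaar E) :=
  inferInstanceAs (IsHaarMeasure (haarMeasure ⊤))

instance instIsProbabilityMeasureUnitaryHaar : IsProbabilityMeasure (unitaryHaar E) :=
  ⟨haarMeasure_self (K₀ := (⊤ : TopologicalSpace.PositiveCompacts (UnitaryOp E)))⟩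

/-- A right translate of Haar measure is again a Haar probability measure, so uniqueness applies. -/
instance instIsMulRightInvariantUnitaryHaar : IsMulRightInvariant (unitaryHaar E) where
  map_mul_right_eq_self g := by
    have : IsProbabilityMeasure (map (· * g) (unitaryHaar E)) :=
      isProbabilityMeasure_map (measurable_mul_const g).aemeasurable
    exact isHaarMeasure_eq_of_isProbabilityMeasure _ _

theorem continuous_unitaryOp_apply (x : E) :
    Continuous fun U : UnitaryOp E => (U : E →L[ℂ] E) x :=
  (ContinuousLinearMap.apply ℂ E x).continuous.comp continuous_subtype_val

theorem integrable_comp_unitaryOp_apply {f : E → ℝ} (hf : Continuous f) (x : E) :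
    Integrable (fun U : UnitaryOp E => f ((U : E →L[ℂ] E) x)) (unitaryHaar E) :=
  (hf.comp (continuous_unitaryOp_apply x)).integrable_of_hasCompactSupport
    (HasCompactSupport.of_compactSpace _)

/-- Two isometric embeddings of the same space differ by a unitary of the target. -/
theorem exists_unitaryOp_apply_eq {H : Type*} [NormedAddCommGroup H] [InnerProductSpace ℂ H]
    (A B : H →ₗᵢ[ℂ] E) : ∃ U : UnitaryOp E, ∀ x, (U : E →L[ℂ] E) (A x) = B x := by
  -- The isometry `B ∘ A⁻¹` on the range of `A` extends to `E`; finite dimension makes the extension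
  -- unitary.
  let L := (B.comp A.equivRange.symm.toLinearIsometry).extend
  refine ⟨Unitary.linearIsometryEquiv.symm (L.toLinearIsometryEquiv rfl), fun x => ?_⟩
  have h := LinearIsometry.extend_apply (B.comp A.equivRange.symm.toLinearIsometry)
    (A.equivRange x)
  simpa using h

/-- The Haar average does not depend on the fiducial unit vector. -/
theorem haarAverage_eq_of_norm_eq_one (f : E → ℝ) {x y : E} (hx : ‖x‖ = 1) (hy : ‖y‖ = 1) :
    haarAverage f x = haarAverage f y := by
  obtain ⟨T, hT⟩ := exists_unitaryOp_apply_eq (LinearIsometry.toSpanSingleton ℂ E hy)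
    (LinearIsometry.toSpanSingleton ℂ E hx)
  have hT1 : (T : E →L[ℂ] E) y = x := by simpa using hT 1
  unfold haarAverage
  rw [← integral_mul_right_eq_self (fun U : UnitaryOp E => f ((U : E →L[ℂ] E) y)) T]
  simp [← hT1]

end HaarUnitary

/-! ### Random subspaces and averages over their unit vectors -/

section Grassmannian

variable {E : Type*} [NormedAddCommGroup E] [InnerProductSpace ℂ E] [FiniteDimensional ℂ E]
  [CompleteSpace E] {k : ℕ}

theorem measurable_starProjection_subspaces :
    Measurable fun W : SubspacesOfDim E k => W.1.starProjection := by
  rw [BorelSpace.measurable_eq (α := E →L[ℂ] E)]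
  exact comap_measurable _

theorem measurable_subspaces_iff {α : Type*} [MeasurableSpace α] {g : α → SubspacesOfDim E k} :
    Measurable g ↔ Measurable fun a => (g a).1.starProjection := by
  refine ⟨measurable_starProjection_subspaces.comp, fun h => ?_⟩
  rw [BorelSpace.measurable_eq (α := E →L[ℂ] E)] at h
  exact measurable_comap_iff.2 h

theorem starProjection_smul_subspaces (U : UnitaryOp E) (W : SubspacesOfDim E k) :
    (U • W).1.starProjection = (U : E →L[ℂ] E) * W.1.starProjection * star (U : E →L[ℂ] E) := by
  ext x
  exact Submodule.starProjection_map_apply (Unitary.linearIsometryEquiv U) W.1 x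

theorem mul_smul_subspaces (U V : UnitaryOp E) (W : SubspacesOfDim E k) :
    (U * V) • W = U • V • W :=
  Subtype.ext (Submodule.map_comp (V : E →L[ℂ] E).toLinearMap (U : E →L[ℂ] E).toLinearMap W.1)

/-- On projectors the action is conjugation. Joint measurability is what Fubini needs later. -/
theorem measurable_smul_subspaces :
    Measurable fun p : UnitaryOp E × SubspacesOfDim E k => p.1 • p.2 := by
  have : ProperSpace (E →L[ℂ] E) := FiniteDimensional.proper ℂ _
  simp only [measurable_subspaces_iff, starProjection_smul_subspaces]
  have h1 : Measurable fun p : UnitaryOp E × SubspacesOfDim E k => (p.1 : E →L[ℂ] E) :=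
    measurable_subtype_coe.comp measurable_fst
  have h2 : Measurable fun p : UnitaryOp E × SubspacesOfDim E k => star (p.1 : E →L[ℂ] E) :=
    continuous_star.measurable.comp h1
  exact (h1.mul (measurable_starProjection_subspaces.comp measurable_snd)).mul h2

/-- The image of the Haar measure under an orbit map is an invariant probability measure. -/
theorem exists_smulInvariant_probabilityMeasure_subspaces (W₀ : SubspacesOfDim E k) :
    ∃ ν : Measure (SubspacesOfDim E k),
      IsProbabilityMeasure ν ∧ SMulInvariantMeasure (UnitaryOp E) _ ν := by
  have horb : Measurable fun U : UnitaryOp E => U • W₀ :=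
    measurable_smul_subspaces.comp (measurable_id.prodMk measurable_const)
  refine ⟨map (fun U : UnitaryOp E => U • W₀) (unitaryHaar E),
    isProbabilityMeasure_map horb.aemeasurable, ⟨fun V s hs => ?_⟩⟩
  have hV : Measurable fun W : SubspacesOfDim E k => V • W :=
    measurable_smul_subspaces.comp (measurable_const.prodMk measurable_id)
  rw [map_apply horb (hV hs), map_apply horb hs,
    ← measure_preimage_mul (unitaryHaar E) V ((fun U : UnitaryOp E => U • W₀) ⁻¹' s)]
  simp only [← Set.preimage_comp, Function.comp_def, mul_smul_subspaces]

variable {H : Type*} [NormedAddCommGroup H] [InnerProductSpace ℂ H] [FiniteDimensional ℂ H]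
  [CompleteSpace H]

/-- The Haar average over an embedded subspace depends only on the image of the embedding. -/
theorem haarAverage_comp_eq_of_range_eq (f : E → ℝ) (A B : H →ₗᵢ[ℂ] E)
    (h : LinearMap.range A.toLinearMap = LinearMap.range B.toLinearMap) (ψ : H) :
    haarAverage (fun x => f (A x)) ψ = haarAverage (fun x => f (B x)) ψ := by
  let e : LinearMap.range A.toLinearMap ≃ₗᵢ[ℂ] LinearMap.range B.toLinearMap :=
    LinearIsometryEquiv.ofEq _ _ h
  -- `T = B⁻¹ A` is a unitary of `H`, absorbed by left invariance of Haar measure.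
  let T : UnitaryOp H :=
    Unitary.linearIsometryEquiv.symm ((A.equivRange.trans e).trans B.equivRange.symm)
  have hT : ∀ x, B ((T : H →L[ℂ] H) x) = A x := fun x =>
    congrArg Subtype.val (B.equivRange.apply_symm_apply (e (A.equivRange x)))
  unfold haarAverage
  rw [← integral_mul_left_eq_self (fun U : UnitaryOp H => f (B ((U : H →L[ℂ] H) ψ))) T]
  simp [hT]

theorem range_unitaryOp_comp (U : UnitaryOp E) (A : H →ₗᵢ[ℂ] E) :
    LinearMap.range ((Unitary.linearIsometryEquiv U).toLinearIsometry.comp A).toLinearMap =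
      (LinearMap.range A.toLinearMap).map (U : E →L[ℂ] E).toLinearMap :=
  LinearMap.range_comp A.toLinearMap (U : E →L[ℂ] E).toLinearMap

theorem haarAverage_smul_subspaces (f : E → ℝ) {ℰ : SubspacesOfDim E k → H →ₗᵢ[ℂ] E}
    (hℰ : ∀ W, LinearMap.range (ℰ W).toLinearMap = W.1) (ψ : H) (V : UnitaryOp E)
    (W : SubspacesOfDim E k) :
    haarAverage (fun x => f (ℰ (V • W) x)) ψ =
      haarAverage (fun x => f ((V : E →L[ℂ] E) (ℰ W x))) ψ := by
  refine haarAverage_comp_eq_of_range_eq f (ℰ (V • W))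
    ((Unitary.linearIsometryEquiv V).toLinearIsometry.comp (ℰ W)) ?_ ψ
  rw [hℰ, range_unitaryOp_comp, hℰ]
  rfl

theorem exists_smul_subspaces_eq {ℰ : SubspacesOfDim E k → H →ₗᵢ[ℂ] E}
    (hℰ : ∀ W, LinearMap.range (ℰ W).toLinearMap = W.1) (W₀ W : SubspacesOfDim E k) :
    ∃ V : UnitaryOp E, V • W₀ = W := by
  obtain ⟨V, hV⟩ := exists_unitaryOp_apply_eq (ℰ W₀) (ℰ W)
  refine ⟨V, Subtype.ext ?_⟩
  change W₀.1.map (V : E →L[ℂ] E).toLinearMap = W.1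
  rw [← hℰ W₀, ← hℰ W, ← range_unitaryOp_comp]
  congr 1
  ext x
  exact hV x

theorem continuous_uncurry_comp_unitaryOp {f : E → ℝ} (hf : Continuous f) (A : H →ₗᵢ[ℂ] E)
    (ψ : H) :
    Continuous fun p : UnitaryOp E × UnitaryOp H =>
      f ((p.1 : E →L[ℂ] E) (A ((p.2 : H →L[ℂ] H) ψ))) := by
  refine hf.comp ((continuous_subtype_val.comp continuous_fst).clm_apply
    (A.continuous.comp ?_))
  exact (continuous_unitaryOp_apply ψ).comp continuous_snd

theorem continuous_haarAverage_unitaryOp {f : E → ℝ} (hf : Continuous f) (A : H →ₗᵢ[ℂ] E)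
    (ψ : H) :
    Continuous fun V : UnitaryOp E => haarAverage (fun x => f ((V : E →L[ℂ] E) (A x))) ψ := by
  have h := continuous_parametric_integral_of_continuous (μ := unitaryHaar H)
    (f := fun (V : UnitaryOp E) (U : UnitaryOp H) =>
      f ((V : E →L[ℂ] E) (A ((U : H →L[ℂ] H) ψ))))
    (continuous_uncurry_comp_unitaryOp hf A ψ) isCompact_univ
  simpa [haarAverage] using h

/-- The average of a continuous function over the unit sphere of a subspace is a measurable
function of the subspace: the orbit map from the unitary group onto the projectors is closed. -/
theorem measurable_haarAverage_subspaces {f : E → ℝ} (hf : Continuous f)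
    {ℰ : SubspacesOfDim E k → H →ₗᵢ[ℂ] E}
    (hℰ : ∀ W, LinearMap.range (ℰ W).toLinearMap = W.1) (ψ : H) :
    Measurable fun W => haarAverage (fun x => f (ℰ W x)) ψ := by
  rcases isEmpty_or_nonempty (SubspacesOfDim E k) with _ | ⟨⟨W₀⟩⟩
  · exact measurable_of_empty _
  let q : UnitaryOp E → (E →L[ℂ] E) := fun V => (V • W₀).1.starProjection
  have hq : Continuous q := by
    simp only [q, starProjection_smul_subspaces]
    exact (continuous_subtype_val.mul continuous_const).mul
      (continuous_star.comp continuous_subtype_val)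
  refine measurable_of_isClosed fun C hC => ?_
  have hK : IsClosed {V : UnitaryOp E | haarAverage (fun x => f (ℰ (V • W₀) x)) ψ ∈ C} := by
    simp only [haarAverage_smul_subspaces f hℰ]
    exact hC.preimage (continuous_haarAverage_unitaryOp hf (ℰ W₀) ψ)
  -- By transitivity, the preimage of `C` consists of the subspaces whose projector lies in the
  -- compact image of this closed set.
  convert measurable_starProjection_subspaces (hK.isCompact.image hq).isClosed.measurableSet
    using 1
  ext W
  constructor
  · intro hW
    obtain ⟨V, rfl⟩ := exists_smul_subspaces_eq hℰ W₀ W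
    exact ⟨V, hW, rfl⟩
  · rintro ⟨V, hV, hVW⟩
    have : V • W₀ = W := Subtype.ext (Submodule.starProjection_inj.1 hVW)
    exact this ▸ hV

/-- Isometries keep every `A (U ψ)` in one compact ball, so the bound is uniform in `A`. -/
theorem exists_norm_haarAverage_comp_le {f : E → ℝ} (hf : Continuous f) (ψ : H) :
    ∃ C : ℝ, ∀ A : H →ₗᵢ[ℂ] E, ‖haarAverage (fun x => f (A x)) ψ‖ ≤ C := by
  have : ProperSpace E := FiniteDimensional.proper ℂ E
  obtain ⟨C, hC⟩ := (isCompact_closedBall (0 : E) ‖ψ‖).exists_bound_of_continuousOn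
    hf.continuousOn
  refine ⟨C, fun A => ?_⟩
  have h := norm_integral_le_of_norm_le_const (μ := unitaryHaar H)
    (f := fun U : UnitaryOp H => f (A ((U : H →L[ℂ] H) ψ))) (C := C)
    (Filter.Eventually.of_forall fun U => hC _ (by simp [Unitary.norm_map]))
  simpa [haarAverage] using h

theorem integrable_haarAverage_subspaces {f : E → ℝ} (hf : Continuous f)
    {ℰ : SubspacesOfDim E k → H →ₗᵢ[ℂ] E}
    (hℰ : ∀ W, LinearMap.range (ℰ W).toLinearMap = W.1) (ψ : H)
    (ν : Measure (SubspacesOfDim E k)) [IsFiniteMeasure ν] :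
    Integrable (fun W => haarAverage (fun x => f (ℰ W x)) ψ) ν := by
  obtain ⟨C, hC⟩ := exists_norm_haarAverage_comp_le hf ψ
  exact .of_bound (measurable_haarAverage_subspaces hf hℰ ψ).aestronglyMeasurable C
    (Filter.Eventually.of_forall fun W => hC (ℰ W))

/-- Averaging over the unitaries of the ambient space erases the embedding. -/
theorem integral_haarAverage_unitaryOp {f : E → ℝ} (hf : Continuous f) (A : H →ₗᵢ[ℂ] E)
    {ψ : H} (hψ : ‖ψ‖ = 1) {φ : E} (hφ : ‖φ‖ = 1) :
    ∫ V : UnitaryOp E, haarAverage (fun x => f ((V : E →L[ℂ] E) (A x))) ψ ∂(unitaryHaar E) =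
      haarAverage f φ := by
  have hint : Integrable (Function.uncurry fun (V : UnitaryOp E) (U : UnitaryOp H) =>
      f ((V : E →L[ℂ] E) (A ((U : H →L[ℂ] H) ψ)))) ((unitaryHaar E).prod (unitaryHaar H)) :=
    (continuous_uncurry_comp_unitaryOp hf A ψ).integrable_of_hasCompactSupport
      (HasCompactSupport.of_compactSpace _)
  calc _ = ∫ U : UnitaryOp H, haarAverage f (A ((U : H →L[ℂ] H) ψ)) ∂(unitaryHaar H) :=
        integral_integral_swap hint
    _ = ∫ _ : UnitaryOp H, haarAverage f φ ∂(unitaryHaar H) := by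
        congr 1 with U
        exact haarAverage_eq_of_norm_eq_one f (by simp [Unitary.norm_map, hψ]) hφ
    _ = haarAverage f φ := by simp

/-- Averaging a continuous function over a random state of a random subspace is averaging it over
a random state of the ambient space. -/
theorem integral_haarAverage_subspaces {f : E → ℝ} (hf : Continuous f)
    {ℰ : SubspacesOfDim E k → H →ₗᵢ[ℂ] E}
    (hℰ : ∀ W, LinearMap.range (ℰ W).toLinearMap = W.1) (ν : Measure (SubspacesOfDim E k))
    [IsProbabilityMeasure ν] [SMulInvariantMeasure (UnitaryOp E) _ ν]
    {ψ : H} (hψ : ‖ψ‖ = 1) {φ : E} (hφ : ‖φ‖ = 1) :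
    ∫ W, haarAverage (fun x => f (ℰ W x)) ψ ∂ν = haarAverage f φ := by
  set F : SubspacesOfDim E k → ℝ := fun W => haarAverage (fun x => f (ℰ W x)) ψ with hF
  have hFm : Measurable F := measurable_haarAverage_subspaces hf hℰ ψ
  have hV (V : UnitaryOp E) : ∫ W, F (V • W) ∂ν = ∫ W, F W ∂ν := by
    have hm : Measurable fun W : SubspacesOfDim E k => V • W :=
      measurable_smul_subspaces.comp (measurable_const.prodMk measurable_id)
    have hmap : map (fun W => V • W) ν = ν := by
      ext s hs
      rw [map_apply hm hs, SMulInvariantMeasure.measure_preimage_smul V hs]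
    rw [← integral_map hm.aemeasurable hFm.aestronglyMeasurable, hmap]
  have hint : Integrable (Function.uncurry fun (V : UnitaryOp E) W => F (V • W))
      ((unitaryHaar E).prod ν) := by
    obtain ⟨C, hC⟩ := exists_norm_haarAverage_comp_le hf ψ
    exact .of_bound (hFm.comp measurable_smul_subspaces).aestronglyMeasurable C
      (Filter.Eventually.of_forall fun p => hC _)
  calc ∫ W, F W ∂ν = ∫ V : UnitaryOp E, ∫ W, F (V • W) ∂ν ∂(unitaryHaar E) := by simp [hV]
    _ = ∫ W, ∫ V : UnitaryOp E, F (V • W) ∂(unitaryHaar E) ∂ν := integral_integral_swap hint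
    _ = ∫ _, haarAverage f φ ∂ν := by
        congr 1 with W
        simp only [hF, haarAverage_smul_subspaces f hℰ]
        exact integral_haarAverage_unitaryOp hf (ℰ W) hψ hφ
    _ = haarAverage f φ := by simp

end Grassmannian

/-! ### Application to the stabilizer entropy -/

section StabilizerEntropy

theorem continuous_stabEntropy {d n : ℕ} [NeZero d] :
    Continuous (stabEntropy : QuditSpace d n → ℝ) := by
  unfold stabEntropy weylProb
  have h : Continuous (pureState : QuditSpace d n → _) :=
    continuous_matrix fun i j => by
      simp only [pureState, Matrix.of_apply]
      fun_prop
  have ha (a : Fin n → ZMod d × ZMod d) : Continuous fun ψ : QuditSpace d n =>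
      ((multiDisplacement d n a).conjTranspose * pureState ψ).trace :=
    (continuous_const.matrix_mul h).matrix_trace
  fun_prop

theorem aseGap_eq_extrinsicASE_sub {dS nS dB nB : ℕ} [NeZero dS] [NeZero dB]
    (ℰ : QuditSpace dS nS →ₗᵢ[ℂ] QuditSpace dB nB) (ψ : QuditSpace dS nS) :
    aseGap ℰ ψ = extrinsicASE ℰ ψ - haarAverage stabEntropy ψ :=
  integral_sub (integrable_comp_unitaryOp_apply (continuous_stabEntropy.comp ℰ.continuous) ψ)
    (integrable_comp_unitaryOp_apply continuous_stabEntropy ψ)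

theorem finrank_quditSpace (d n : ℕ) [NeZero d] : Module.finrank ℂ (QuditSpace d n) = d ^ n := by
  simp [ZMod.card]

end StabilizerEntropy

theorem theorem1 (dS nS dB nB : ℕ) [NeZero dS] [NeZero dB] (hdim : dS ^ nS ≤ dB ^ nB) :
    (∃ ν : Measure (SubspacesOfDim (QuditSpace dB nB) (dS ^ nS)),
      IsProbabilityMeasure ν ∧ SMulInvariantMeasure (UnitaryOp (QuditSpace dB nB)) _ ν) ∧
    ∀ (ν : Measure (SubspacesOfDim (QuditSpace dB nB) (dS ^ nS))) [IsProbabilityMeasure ν]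
      [SMulInvariantMeasure (UnitaryOp (QuditSpace dB nB)) _ ν]
      -- for each subspace, any isometric embedding of the small space onto it
      (ℰ : SubspacesOfDim (QuditSpace dB nB) (dS ^ nS) →
        (QuditSpace dS nS →ₗᵢ[ℂ] QuditSpace dB nB))
      (_ : ∀ W, LinearMap.range (ℰ W).toLinearMap = W.1)
      -- fiducial pure states of the small and of the big system
      (ψ : QuditSpace dS nS) (_ : ‖ψ‖ = 1) (φ : QuditSpace dB nB) (_ : ‖φ‖ = 1),
      (Integrable (fun W => aseGap (ℰ W) ψ) ν ∧
        ∫ W, aseGap (ℰ W) ψ ∂ν = haarAverage stabEntropy φ - haarAverage stabEntropy ψ) ∧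
      (Integrable (fun W => extrinsicASE (ℰ W) ψ) ν ∧
        ∫ W, extrinsicASE (ℰ W) ψ ∂ν = haarAverage stabEntropy φ) := by
  refine ⟨?_, fun ν _ _ ℰ hℰ ψ hψ φ hφ => ?_⟩
  -- The dimension inequality provides a subspace of the required dimension, the base point of the
  -- orbit map.
  · obtain ⟨g, hg⟩ := (finrank_le_iff_exists_linearMap (R := ℂ) (M := QuditSpace dS nS)
      (M' := QuditSpace dB nB)).1 (by simpa only [finrank_quditSpace] using hdim)
    exact exists_smulInvariant_probabilityMeasure_subspaces
      ⟨LinearMap.range g, (LinearMap.finrank_range_of_inj hg).trans (finrank_quditSpace dS nS)⟩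
  · have hint : Integrable (fun W => extrinsicASE (ℰ W) ψ) ν :=
      integrable_haarAverage_subspaces continuous_stabEntropy hℰ ψ ν
    have heq : ∫ W, extrinsicASE (ℰ W) ψ ∂ν = haarAverage stabEntropy φ :=
      integral_haarAverage_subspaces continuous_stabEntropy hℰ ν hψ hφ
    simp only [aseGap_eq_extrinsicASE_sub]
    refine ⟨⟨hint.sub (integrable_const _), ?_⟩, hint, heq⟩
    rw [integral_sub hint (integrable_const _), heq]
    simp
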